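/- Let $I\subseteq\mathbb R$ be an interval (bounded or not, with or without its endpoints), and let $w_1,\dots,w_r$ be real weight functions on $I$ all of whose moments $\int_I x^k w_j(x)\,dx$, $k\ge 0$, converge absolutely. Assume that the weights are continuous in the interior of $I$, up to a common positive factor: there is $\rho>0$ on the interior of $I$ such that every $w_j/\rho$ is continuous there (for continuous weights, $\rho=1$). Suppose that $(w_1,\dots,w_r)$ is an AT system on $I$ for every multi-index $\vec n=(n_1,\dots,n_r)\in\mathbb N^r$, that is, the $|\vec n|=n_1+\cdots+n_r$ functions $x^kw_j(x)$, $1\le j\le r$, $0\le k\le n_j-1$, are linearly independent on $I$ and every nontrivial linear combination of them has at most $|\vec n|-1$ zeros on $I$. Then for every $\vec n\in\mathbb N^r$ there is exactly one monic polynomial $P_{\vec n}$ of degree $|\vec n|$ with $\int_I P_{\vec n}(x)x^kw_j(x)\,dx=0$ for $1\le j\le r$ and $0\le k\le n_j-1$ (the type II multiple orthogonal polynomial). Let $l$ be an odd positive integer. A path of $l$ multi-indices starting from $\vec n$ is a sequence $\vec n=\vec n_0\le\vec n_1\le\cdots\le\vec n_{l-1}$ (componentwise) in $\mathbb N^r$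 with $|\vec n_j|=|\vec n|+j$; its Wronskian is the polynomial $$W(\vec n_0,\dots,\vec n_{l-1};x)=\det\bigl(P^{(i)}_{\vec n_j}(x)\bigr)_{i,j=0}^{l-1}.$$ 1. For every path of $l$ multi-indices starting from $\vec n$, the Wronskian has exactly $|\vec n|$ real zeros, and all of them are simple. 2. Consider a path of $l$ multi-indices starting from $\vec n$ and a path of $l$ multi-indices ending at $\vec m$, such that the last $l-1$ multi-indices of the first path coincide with the first $l-1$ multi-indices of the second, $|\vec m|=|\vec n|+l$ and $\vec n\le\vec m$ (the last two conditions follow from the overlap if $l\ge 3$). Then the real zeros $x_1<\cdots<x_{|\vec n|}$ of the first Wronskian and $y_1<\cdots<y_{|\vec n|+1}$ of the second strictly interlace: $y_1<x_1<y_2<x_2<\cdots<x_{|\vec n|}<y_{|\vec n|+1}$. -/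

import Mathlib

open Polynomial MeasureTheory

noncomputable section

namespace MOP

/-- A finite family of real functions is a Chebyshev system on `I` if the functions are linearly
independent on `I` and every nontrivial linear combination of the `n` functions has at most `n - 1`
zeros on `I`. -/
def IsChebyshevSystem {ι : Type} [Fintype ι] (φ : ι → ℝ → ℝ) (I : Set ℝ) : Prop :=
  LinearIndependent ℝ (fun (i : ι) (x : I) => φ i x) ∧
    ∀ a : ι → ℝ, a ≠ 0 → {x ∈ I | ∑ i, a i * φ i x = 0}.encard < (Fintype.card ι : ℕ∞)

/-- The weights `w` form an AT system on `I` for the multi-index `n`: the functions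
`x ^ k * w j x` with `0 ≤ k ≤ n j - 1` form a Chebyshev system on `I`. -/
def IsATSystem {r : ℕ} (w : Fin r → ℝ → ℝ) (I : Set ℝ) (n : Fin r → ℕ) : Prop :=
  IsChebyshevSystem (fun (i : (j : Fin r) × Fin (n j)) (x : ℝ) => x ^ (i.2 : ℕ) * w i.1 x) I

/-- The size `|n| = n₁ + ⋯ + n_r` of a multi-index. -/
def size {r : ℕ} (n : Fin r → ℕ) : ℕ := ∑ j, n j

/-- `P` is a type II multiple orthogonal polynomial for the multi-index `n`: it is monic of degree
`|n|` and orthogonal to `1, x, …, x ^ (n j - 1)` with respect to `w j`, for every `j`. -/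
def IsTypeII {r : ℕ} (w : Fin r → ℝ → ℝ) (I : Set ℝ) (n : Fin r → ℕ) (P : ℝ[X]) : Prop :=
  P.Monic ∧ P.natDegree = size n ∧
    ∀ j : Fin r, ∀ k < n j, ∫ x in I, P.eval x * x ^ k * w j x = 0

/-- The type II multiple orthogonal polynomial `P_n` (arbitrary if there is none). -/
def typeII {r : ℕ} (w : Fin r → ℝ → ℝ) (I : Set ℝ) (n : Fin r → ℕ) : ℝ[X] :=
  Classical.epsilon (IsTypeII w I n)

/-- The Wronskian determinant of `l` polynomials; row `i` holds the `i`-th derivatives. -/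
def wronskianDet {l : ℕ} (f : Fin l → ℝ[X]) : ℝ[X] :=
  Matrix.det (Matrix.of fun i j : Fin l => derivative^[(i : ℕ)] (f j))

/-- `p` is a path of `l` multi-indices starting from `n`: `p 0 = n`, `|p j| = |n| + j`, and `p` is
componentwise nondecreasing. -/
def IsPath {r l : ℕ} (n : Fin r → ℕ) (p : Fin l → Fin r → ℕ) : Prop :=
  (∀ j : Fin l, (j : ℕ) = 0 → p j = n) ∧ (∀ j : Fin l, size (p j) = size n + (j : ℕ)) ∧ Monotone p

/-- The Wronskian of the type II multiple orthogonal polynomials along a path. -/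
def pathWronskian {r l : ℕ} (w : Fin r → ℝ → ℝ) (I : Set ℝ) (p : Fin l → Fin r → ℕ) : ℝ[X] :=
  wronskianDet fun j => typeII w I (p j)

/-- The real zeros of a polynomial. -/
def realZeros (f : ℝ[X]) : Set ℝ := {x | f.eval x = 0}

/-- `A = {x₀, …, x_{k-1}}` and `B = {y₀, …, y_k}` with `y₀ < x₀ < y₁ < x₁ < ⋯ < x_{k-1} < y_k`. -/
def StrictlyInterlace (k : ℕ) (A B : Set ℝ) : Prop :=
  ∃ (x : Fin k → ℝ) (y : Fin (k + 1) → ℝ), Set.range x = A ∧ Set.range y = B ∧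
    ∀ i : Fin k, y i.castSucc < x i ∧ x i < y i.succ

end MOP

end

/-! An even number of consecutive polynomials has a Wronskian without real zeros. A zero at `x₀`
would give a nontrivial combination `Q` of the polynomials divisible by `(X - x₀) ^ l`, of degree
less than `|n| + l` and orthogonal to the system of `n`. The cofactor of `(X - x₀) ^ l` then changes
sign fewer than `|n|` times in the interior of `I`. The AT property supplies a combination `φ` of
the system with exactly these sign changes, so `Q * φ` keeps one sign and its integral cannot vanish
(`IsOrthogonal.le_natDegree`, `wronskianDet_eval_ne_zero_of_even`).

For odd `l`, let `f` and `g` be the Wronskians of the first and the last `l` members of a path of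
length `l + 1`. By Jacobi's determinant identity, `f' g - f g'` is up to sign the product of the
Wronskians of the whole path and of its `l - 1` middle members, both of even length; hence it has no
real zero (`wronskianDet_jacobi_ne_zero`). So `f` and `g` have only simple real zeros, none in
common, and the zeros of each separate those of the other. The leading terms make `f' g - f g'`
negative, which forces a zero of `g` beyond the extreme zeros of `f` on both sides
(`strictlyInterlace_of_cross_derivative_ne_zero`). Thus `g` has exactly one real zero more than `f`,
and induction on `|n|` counts the zeros, starting from `|n| = 0`, where the Wronskian is constant.
-/

/-! ### Polynomials at infinity -/

open Filter Topology in
theorem Polynomial.tendsto_eval_div_pow {p : ℝ[X]} {N : ℕ} (hp : p.natDegree ≤ N) :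
    Tendsto (fun x => p.eval x / x ^ N) atTop (𝓝 (p.coeff N)) := by
  rcases hp.lt_or_eq with h | h
  · rw [coeff_eq_zero_of_natDegree_lt h]
    have := div_tendsto_atTop_zero_of_degree_lt p (X ^ N : ℝ[X])
      (by rw [degree_X_pow]; exact degree_le_natDegree.trans_lt (by exact_mod_cast h))
    simpa using this
  · by_cases h0 : p = 0
    · simp [h0]
    have := div_tendsto_atTop_leadingCoeff_div_of_degree_eq p (X ^ N : ℝ[X])
      (by rw [degree_X_pow, degree_eq_natDegree h0, h])
    simpa [leadingCoeff, h] using this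

open Filter Topology in
theorem Polynomial.natDegree_eq_and_leadingCoeff_eq_of_tendsto {p : ℝ[X]} {N : ℕ} {a : ℝ}
    (ha : a ≠ 0) (h : Tendsto (fun x => p.eval x / x ^ N) atTop (𝓝 a)) :
    p.natDegree = N ∧ p.leadingCoeff = a := by
  have hle : p.natDegree ≤ N := by
    by_contra! hlt
    have h1 := abs_div_tendsto_atTop_atTop_of_degree_gt p (X ^ N : ℝ[X])
      (by rw [degree_X_pow, degree_eq_natDegree (ne_zero_of_natDegree_gt hlt)]
          exact_mod_cast hlt) (by simp)
    simp only [eval_pow, eval_X] at h1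
    exact not_tendsto_nhds_of_tendsto_atTop h1 _ h.abs
  have hc : p.coeff N = a := tendsto_nhds_unique (tendsto_eval_div_pow hle) h
  have hN : p.natDegree = N := le_antisymm hle (le_natDegree_of_ne_zero (hc ▸ ha))
  exact ⟨hN, by rw [leadingCoeff, hN, hc]⟩

/-! ### Derivatives of Wronskians and Jacobi's identity -/

theorem Matrix.derivative_det {n R : Type*} [Fintype n] [DecidableEq n] [CommRing R]
    (M : Matrix n n R[X]) :
    derivative M.det = ∑ i, (M.updateCol i fun k => derivative (M k i)).det := by
  simp only [Matrix.det_apply', derivative_sum]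
  rw [Finset.sum_comm]
  refine Finset.sum_congr rfl fun σ _ => ?_
  rw [derivative_intCast_mul, derivative_prod_finset, Finset.mul_sum]
  refine Finset.sum_congr rfl fun i _ => ?_
  rw [← Finset.mul_prod_erase Finset.univ _ (Finset.mem_univ i)]
  congr 1
  rw [Matrix.updateCol_self, mul_comm]
  congr 1
  refine Finset.prod_congr rfl fun j hj => ?_
  rw [Matrix.updateCol_ne (Finset.ne_of_mem_erase hj)]

namespace MOP

/-- Differentiating any row but the last duplicates the next row, so only one term survives.
Indexing rows by `succAbove` makes it a minor of the Wronskian matrix of size `k + 2`. -/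
theorem derivative_wronskianDet {k : ℕ} (f : Fin (k + 1) → ℝ[X]) :
    derivative (wronskianDet f) = Matrix.det (Matrix.of fun i j : Fin (k + 1) =>
      derivative^[((Fin.last k).castSucc.succAbove i : ℕ)] (f j)) := by
  rw [wronskianDet, ← Matrix.det_transpose, Matrix.derivative_det,
    Fin.sum_univ_castSucc, Finset.sum_eq_zero, zero_add, ← Matrix.det_transpose]
  · congr 1
    ext1 i j
    refine Fin.lastCases ?_ (fun i => ?_) i
    · simp [Function.iterate_succ_apply']
    · have h : (i.castSucc : Fin (k + 1)) ≠ Fin.last k := (Fin.castSucc_lt_last i).ne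
      rw [Matrix.transpose_apply, Matrix.updateCol_ne h,
        Matrix.of_apply, Matrix.transpose_apply, Matrix.of_apply,
        Fin.succAbove_of_castSucc_lt _ _ (Fin.castSucc_lt_castSucc_iff.2 (Fin.castSucc_lt_last i))]
      simp
  · intro i _
    refine Matrix.det_zero_of_column_eq (i := i.castSucc) (j := i.succ)
      (Fin.castSucc_lt_succ).ne fun m => ?_
    rw [Matrix.updateCol_self, Matrix.updateCol_ne (Fin.castSucc_lt_succ).ne']
    simp [Function.iterate_succ_apply']

theorem eval_det {n : ℕ} (x : ℝ) (M : Matrix (Fin n) (Fin n) ℝ[X]) :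
    M.det.eval x = (Matrix.of fun i j => (M i j).eval x).det := by
  rw [← coe_evalRingHom, RingHom.map_det]
  rfl

/-- By Jacobi's identity the expression is, up to sign, the product of the two Wronskians assumed
nonzero. Only nonvanishing is needed, and it follows from linear algebra: the four Wronskians
involved are entries of the adjugate of `M`, in rows `0`, `d` and columns `c`, `d`. -/
theorem wronskianDet_jacobi_ne_zero {k : ℕ} (f : Fin (k + 2) → ℝ[X]) (x : ℝ)
    (hf : (wronskianDet f).eval x ≠ 0)
    (hmid : (wronskianDet fun j : Fin k => f j.castSucc.succ).eval x ≠ 0) :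
    (derivative (wronskianDet fun j => f j.castSucc) * wronskianDet (fun j => f j.succ)
      - wronskianDet (fun j => f j.castSucc) * derivative (wronskianDet fun j => f j.succ)).eval x
      ≠ 0 := by
  set M : Matrix (Fin (k + 2)) (Fin (k + 2)) ℝ :=
    Matrix.of fun i j => (derivative^[(i : ℕ)] (f j)).eval x with hM
  set c : Fin (k + 2) := (Fin.last k).castSucc with hc
  set d : Fin (k + 2) := Fin.last (k + 1) with hd
  have hcd : c ≠ d := (Fin.castSucc_lt_last _).ne
  have hdet : M.det ≠ 0 := by rwa [wronskianDet, eval_det] at hf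
  have e1 : (wronskianDet fun j : Fin (k + 1) => f j.castSucc).eval x
      = (M.submatrix d.succAbove d.succAbove).det := by
    rw [wronskianDet, eval_det]
    congr 1
    ext i j
    simp [hM, hd]
  have e2 : (wronskianDet fun j : Fin (k + 1) => f j.succ).eval x
      = (M.submatrix d.succAbove (Fin.succAbove 0)).det := by
    rw [wronskianDet, eval_det]
    congr 1
    ext i j
    simp [hM, hd]
  have e3 : (derivative (wronskianDet fun j : Fin (k + 1) => f j.castSucc)).eval x
      = (M.submatrix c.succAbove d.succAbove).det := by
    rw [derivative_wronskianDet, eval_det]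
    congr 1
    ext i j
    simp [hM, hd, hc]
  have e4 : (derivative (wronskianDet fun j : Fin (k + 1) => f j.succ)).eval x
      = (M.submatrix c.succAbove (Fin.succAbove 0)).det := by
    rw [derivative_wronskianDet, eval_det]
    congr 1
  rw [eval_sub, eval_mul, eval_mul, e1, e2, e3, e4]
  intro h0
  have a1 := M.adjugate_fin_succ_eq_det_submatrix d d
  have a2 := M.adjugate_fin_succ_eq_det_submatrix 0 d
  have a3 := M.adjugate_fin_succ_eq_det_submatrix d c
  have a4 := M.adjugate_fin_succ_eq_det_submatrix 0 c
  have hzero : M.adjugate d c * M.adjugate 0 d - M.adjugate d d * M.adjugate 0 c = 0 := by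
    rw [a1, a2, a3, a4]
    simp only [Fin.val_zero, add_zero, pow_add]
    linear_combination (-1) ^ (c : ℕ) * (-1) ^ (d : ℕ) * (-1) ^ (d : ℕ) * h0
  -- By `hzero` the 2 × 2 block of the adjugate is singular, so its columns are dependent; the
  -- coefficients are read off a row of the block that is not zero.
  obtain ⟨a, b, hab, h1, h2⟩ : ∃ a b : ℝ, (a ≠ 0 ∨ b ≠ 0) ∧
      a * M.adjugate 0 c + b * M.adjugate 0 d = 0 ∧
      a * M.adjugate d c + b * M.adjugate d d = 0 := by
    by_cases hz : M.adjugate 0 c = 0 ∧ M.adjugate 0 d = 0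
    · by_cases hz' : M.adjugate d c = 0 ∧ M.adjugate d d = 0
      · exact ⟨1, 0, by simp, by simp [hz.1], by simp [hz'.1]⟩
      · exact ⟨M.adjugate d d, -M.adjugate d c, by
          rw [neg_ne_zero]; tauto, by simp [hz.1, hz.2], by ring⟩
    · exact ⟨M.adjugate 0 d, -M.adjugate 0 c, by
          rw [neg_ne_zero]; tauto, by ring, by linear_combination hzero⟩
  set v : Fin (k + 2) → ℝ := fun j => a * M.adjugate j c + b * M.adjugate j d with hv
  have hMv : ∀ i, ∑ j, M i j * v j = M.det * (a * (if i = c then 1 else 0)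
      + b * (if i = d then 1 else 0)) := by
    intro i
    have key := M.mul_adjugate
    have k1 := congrFun (congrFun key i) c
    have k2 := congrFun (congrFun key i) d
    simp only [Matrix.mul_apply, Matrix.smul_apply, Matrix.one_apply, smul_eq_mul] at k1 k2
    calc ∑ j, M i j * v j = a * ∑ j, M i j * M.adjugate j c + b * ∑ j, M i j * M.adjugate j d := by
          rw [Finset.mul_sum, Finset.mul_sum, ← Finset.sum_add_distrib]
          exact Finset.sum_congr rfl fun j _ => by simp only [hv]; ring
      _ = _ := by rw [k1, k2]; ring
  -- The first and last entries of `v` vanish, and `M v` is zero outside the last two rows `c`, `d`.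
  -- The middle entries thus lie in the kernel of the middle Wronskian matrix. Then `v = 0`, and
  -- rows `c` and `d` of `hMv` force `a = b = 0`.
  have hv0 : v = 0 := by
    have hsub : (fun j : Fin k => v j.castSucc.succ) = 0 := by
      rw [wronskianDet, eval_det] at hmid
      refine Matrix.eq_zero_of_mulVec_eq_zero hmid ?_
      ext i
      have hi := hMv i.castSucc.castSucc
      rw [Fin.sum_univ_succ, Fin.sum_univ_castSucc, if_neg, if_neg] at hi
      · have h1' : v 0 = 0 := h1
        have h2' : v (Fin.last k).succ = 0 := h2
        rw [h1', h2'] at hi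
        simpa [Matrix.mulVec, dotProduct, hM] using hi
      · exact (Fin.castSucc_lt_last _).ne
      · simp [hc, (Fin.castSucc_lt_last _).ne]
    ext j
    refine Fin.cases h1 (fun j => ?_) j
    refine Fin.lastCases h2 (fun j => ?_) j
    exact congrFun hsub j
  have hc' := hMv c
  have hd' := hMv d
  simp only [hv0, Pi.zero_apply, mul_zero, Finset.sum_const_zero, if_true, if_neg hcd,
    if_neg hcd.symm, mul_one, add_zero, zero_add] at hc' hd'
  have := mul_eq_zero.1 hc'.symm
  have := mul_eq_zero.1 hd'.symm
  tauto

/-! ### Degree and leading coefficient of the Wronskian -/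

-- Multiplying row `i` by `x ^ i` and dividing column `j` by `x ^ (d + j)` divides the determinant
-- by `x ^ (l * d)` in total. The scaled entries tend to falling factorials of `d + j`, whose
-- determinant is the Vandermonde determinant of the increasing nodes `d + j`, hence positive.
open Filter Topology in
theorem wronskianDet_natDegree_leadingCoeff {l : ℕ} (f : Fin l → ℝ[X]) (d : ℕ)
    (hf : ∀ j, (f j).Monic) (hdeg : ∀ j, (f j).natDegree = d + j) :
    (wronskianDet f).natDegree = l * d ∧ 0 < (wronskianDet f).leadingCoeff := by
  set V : ℝ := (Matrix.vandermonde fun j : Fin l => ((d + j : ℕ) : ℝ)).det with hV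
  have hVpos : 0 < V := by
    rw [hV, Matrix.det_vandermonde]
    refine Finset.prod_pos fun i _ => Finset.prod_pos fun j hj => ?_
    rw [sub_pos, Nat.cast_lt]
    have : i < j := Finset.mem_Ioi.1 hj
    omega
  have hcoeff : ∀ i j : Fin l, (X ^ (i : ℕ) * derivative^[(i : ℕ)] (f j)).coeff (d + j)
      = (descPochhammer ℝ i).eval ((d + j : ℕ) : ℝ) := by
    intro i j
    rw [descPochhammer_eval_eq_descFactorial, coeff_X_pow_mul']
    split_ifs with h
    · rw [coeff_iterate_derivative, Nat.sub_add_cancel h, ← hdeg j, (hf j).coeff_natDegree]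
      simp
    · rw [Nat.descFactorial_eq_zero_iff_lt.2 (not_le.1 h), Nat.cast_zero]
  have hnat : ∀ i j : Fin l, (X ^ (i : ℕ) * derivative^[(i : ℕ)] (f j)).natDegree ≤ d + j := by
    intro i j
    by_cases h : (f j).natDegree < i
    · rw [iterate_derivative_eq_zero h]
      simp
    · refine natDegree_mul_le.trans ?_
      have := natDegree_iterate_derivative (f j) i
      have h2 := natDegree_X_pow (R := ℝ) (i : ℕ)
      rw [hdeg] at *
      omega
  have hlim : Tendsto (fun x => (wronskianDet f).eval x / x ^ (l * d)) atTop (𝓝 V) := by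
    have h1 : Tendsto (fun x : ℝ => (Matrix.of fun i j : Fin l =>
        (X ^ (i : ℕ) * derivative^[(i : ℕ)] (f j)).eval x / x ^ (d + (j : ℕ))).det) atTop
        (𝓝 (Matrix.of fun i j : Fin l =>
          (descPochhammer ℝ i).eval ((d + j : ℕ) : ℝ)).det) := by
      refine ((continuous_id.matrix_det).tendsto _).comp ?_
      refine tendsto_pi_nhds.2 fun i => tendsto_pi_nhds.2 fun j => ?_
      rw [Matrix.of_apply, ← hcoeff]
      exact tendsto_eval_div_pow (hnat i j)
    have h2 : (Matrix.of fun i j : Fin l =>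
          (descPochhammer ℝ i).eval ((d + j : ℕ) : ℝ)).det = V := by
      rw [hV, ← Matrix.det_transpose, Matrix.det_eval_matrixOfPolynomials_eq_det_vandermonde _
        (fun i : Fin l => descPochhammer ℝ i) (fun i => descPochhammer_natDegree ℝ i)
        (fun i => monic_descPochhammer ℝ i)]
      rfl
    rw [h2] at h1
    refine h1.congr' ?_
    filter_upwards [eventually_gt_atTop 0] with x hx
    have e : (Matrix.of fun i j : Fin l =>
        (X ^ (i : ℕ) * derivative^[(i : ℕ)] (f j)).eval x / x ^ (d + (j : ℕ)))
        = Matrix.of fun i j : Fin l => x ^ (i : ℕ) * (Matrix.of fun i j : Fin l =>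
          (x ^ (d + (j : ℕ)))⁻¹ *
            (Matrix.of fun i j : Fin l => (derivative^[(i : ℕ)] (f j)).eval x) i j) i j := by
      ext i j
      simp only [Matrix.of_apply, eval_mul, eval_pow, eval_X]
      ring
    rw [e, Matrix.det_mul_column (fun i : Fin l => x ^ (i : ℕ)),
      Matrix.det_mul_row (fun j : Fin l => (x ^ (d + (j : ℕ)))⁻¹), wronskianDet, eval_det]
    simp only [Matrix.of_apply]
    rw [← mul_assoc, ← Finset.prod_mul_distrib, div_eq_inv_mul]
    congr 1
    rw [pow_mul', ← Fin.prod_const, ← Finset.prod_inv_distrib]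
    refine Finset.prod_congr rfl fun i _ => ?_
    rw [pow_add]
    field_simp
  obtain ⟨h1, h2⟩ := natDegree_eq_and_leadingCoeff_eq_of_tendsto hVpos.ne' hlim
  exact ⟨h1, h2 ▸ hVpos⟩

/-! ### Interlacing of zeros from the sign of the cross derivative -/

/-- Each of the `k + 1` gaps left by `A` contains a point of `B`, and not two, since a point of `A`
would separate them. -/
theorem strictlyInterlace_of_separated {k : ℕ} {A B : Set ℝ} (hA : A.encard = k)
    (hdisj : Disjoint A B) (hB : B.Nonempty)
    (hAB : ∀ a ∈ A, ∀ a' ∈ A, a < a' → ∃ b ∈ B, a < b ∧ b < a')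
    (hBA : ∀ b ∈ B, ∀ b' ∈ B, b < b' → ∃ a ∈ A, b < a ∧ a < b')
    (habove : ∀ a ∈ A, ∃ b ∈ B, a < b) (hbelow : ∀ a ∈ A, ∃ b ∈ B, b < a) :
    StrictlyInterlace k A B ∧ B.encard = (k + 1 : ℕ) := by
  have hfin : A.Finite := Set.finite_of_encard_eq_coe hA
  have hcard : hfin.toFinset.card = k := by
    rw [hfin.encard_eq_coe_toFinset_card] at hA
    exact_mod_cast hA
  set x : Fin k → ℝ := ⇑(hfin.toFinset.orderEmbOfFin hcard) with hxdef
  have hx : StrictMono x := (hfin.toFinset.orderEmbOfFin hcard).strictMono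
  have hxA : Set.range x = A := by simp [hxdef]
  have hmem : ∀ j, x j ∈ A := fun j => hxA ▸ Set.mem_range_self j
  have hex : ∀ i : Fin (k + 1), ∃ b ∈ B, ∀ j : Fin k,
      (j.castSucc < i → x j < b) ∧ (i ≤ j.castSucc → b < x j) := by
    intro i
    obtain rfl | hk := Nat.eq_zero_or_pos k
    · obtain ⟨b, hb⟩ := hB
      exact ⟨b, hb, fun j => j.elim0⟩
    by_cases hi0 : (i : ℕ) = 0
    · obtain ⟨b, hb, hlt⟩ := hbelow (x ⟨0, hk⟩) (hmem _)
      refine ⟨b, hb, fun j => ⟨fun h => ?_, fun _ => hlt.trans_le (hx.monotone ?_)⟩⟩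
      · rw [Fin.lt_def] at h; omega
      · exact Nat.zero_le _
    by_cases hik : (i : ℕ) = k
    · obtain ⟨b, hb, hlt⟩ := habove (x ⟨k - 1, by omega⟩) (hmem _)
      refine ⟨b, hb, fun j => ⟨fun _ => (hx.monotone ?_).trans_lt hlt, fun h => ?_⟩⟩
      · rw [Fin.le_def]; have := j.2; simp only; omega
      · have := j.2; rw [Fin.le_def, Fin.val_castSucc] at h; omega
    · have hi := i.2
      obtain ⟨b, hb, h1, h2⟩ := hAB (x ⟨i - 1, by omega⟩) (hmem _) (x ⟨i, by omega⟩) (hmem _)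
        (hx (by rw [Fin.lt_def]; simp only; omega))
      refine ⟨b, hb, fun j => ⟨fun h => (hx.monotone ?_).trans_lt h1,
        fun h => h2.trans_le (hx.monotone ?_)⟩⟩
      · rw [Fin.lt_def, Fin.val_castSucc] at h; rw [Fin.le_def]; simp only; omega
      · exact h
  choose y hyB hy using hex
  have hyx : ∀ i : Fin k, y i.castSucc < x i ∧ x i < y i.succ := fun i =>
    ⟨(hy i.castSucc i).2 le_rfl, (hy i.succ i).1 Fin.castSucc_lt_succ⟩
  have hymono : StrictMono y :=
    Fin.strictMono_iff_lt_succ.2 fun i => (hyx i).1.trans (hyx i).2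
  have hyrange : Set.range y = B := by
    refine Set.Subset.antisymm (Set.range_subset_iff.2 hyB) fun b hb => ?_
    classical
    have hne : ∀ j, x j ≠ b := fun j h => hdisj.le_bot ⟨h ▸ hmem j, hb⟩
    -- The least such `m` is the index of the gap of `A` that contains `b`.
    have hP : ∃ m : ℕ, m ≤ k ∧ ∀ j : Fin k, m ≤ j → b < x j :=
      ⟨k, le_rfl, fun j hj => absurd j.2 (not_lt.2 hj)⟩
    obtain ⟨him, hi⟩ := Nat.find_spec hP
    have hi' : ∀ j : Fin k, (j : ℕ) < Nat.find hP → x j < b := by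
      intro j hj
      by_contra hnot
      have hlt : b < x j := lt_of_le_of_ne (not_lt.1 hnot) (hne j).symm
      exact Nat.find_min hP hj ⟨j.2.le, fun j' hj' => hlt.trans_le (hx.monotone hj')⟩
    set i : Fin (k + 1) := ⟨Nat.find hP, by omega⟩ with hidef
    refine ⟨i, ?_⟩
    by_contra hyb
    have hgap : ∀ a ∈ A, (a < b ∧ a < y i) ∨ (b < a ∧ y i < a) := by
      intro a ha
      rw [← hxA] at ha
      obtain ⟨j, rfl⟩ := ha
      rcases lt_or_ge (j : ℕ) (Nat.find hP) with h | h
      · exact Or.inl ⟨hi' j h, (hy i j).1 h⟩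
      · exact Or.inr ⟨hi j h, (hy i j).2 h⟩
    rcases lt_or_gt_of_ne hyb with h | h
    · obtain ⟨a, ha, h1, h2⟩ := hBA _ (hyB i) _ hb h
      rcases hgap a ha with h | h <;> linarith
    · obtain ⟨a, ha, h1, h2⟩ := hBA _ hb _ (hyB i) h
      rcases hgap a ha with h | h <;> linarith
  refine ⟨⟨x, y, hxA, hyrange, hyx⟩, ?_⟩
  rw [← hyrange, ← Set.image_univ, hymono.injective.injOn.encard_image]
  simp

/-- Rolle's theorem for `f / g`: its derivative has numerator `f' g - f g'`, and the same hypothesis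
excludes zeros of `g` at the endpoints. -/
theorem exists_root_between {f g : ℝ[X]}
    (h : ∀ x, (derivative f * g - f * derivative g).eval x ≠ 0) {a b : ℝ} (hab : a < b)
    (ha : f.eval a = 0) (hb : f.eval b = 0) : ∃ c, g.eval c = 0 ∧ a < c ∧ c < b := by
  by_contra! hno
  have hg : ∀ c ∈ Set.Icc a b, g.eval c ≠ 0 := by
    intro c hc h0
    rcases hc.1.eq_or_lt with rfl | h1
    · exact h a (by simp [ha, h0])
    rcases hc.2.eq_or_lt with rfl | h2
    · exact h c (by simp [hb, h0])
    exact (hno c h0 h1).not_gt h2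
  obtain ⟨c, hc, hc0⟩ := exists_hasDerivAt_eq_zero (f := fun x => f.eval x / g.eval x)
    (f' := fun x => ((derivative f).eval x * g.eval x - f.eval x * (derivative g).eval x)
      / g.eval x ^ 2) hab
    (f.continuousOn.div g.continuousOn hg) (by simp [ha, hb])
    fun c hc => (f.hasDerivAt c).div (g.hasDerivAt c) (hg c (Set.Ioo_subset_Icc_self hc))
  have hgc := hg c (Set.Ioo_subset_Icc_self hc)
  rw [div_eq_zero_iff] at hc0
  exact h c (by simpa using hc0.resolve_right (pow_ne_zero 2 hgc))

open Filter Topology in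
theorem eventually_pos_of_leadingCoeff_pos {p : ℝ[X]} (hp : 0 < p.leadingCoeff) :
    ∀ᶠ x in atTop, 0 < p.eval x := by
  filter_upwards [(tendsto_eval_div_pow (p := p) le_rfl).eventually_const_lt
    (show 0 < p.coeff p.natDegree from hp), eventually_gt_atTop 0] with x hx h0
  exact (div_pos_iff_of_pos_right (pow_pos h0 _)).1 hx

-- Otherwise `f / g` would decrease strictly from its value `0` at `a`, yet it is positive near
-- infinity.
open Filter in
theorem exists_root_above {f g : ℝ[X]}
    (h : ∀ x, (derivative f * g - f * derivative g).eval x < 0)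
    (hf : 0 < f.leadingCoeff) (hg : 0 < g.leadingCoeff) {a : ℝ} (ha : f.eval a = 0) :
    ∃ b, g.eval b = 0 ∧ a < b := by
  by_contra! hno
  have hga : g.eval a ≠ 0 := fun h0 => (h a).ne (by simp [ha, h0])
  have hne : ∀ c ∈ Set.Ici a, g.eval c ≠ 0 := by
    intro c hc h0
    rcases (Set.mem_Ici.1 hc).eq_or_lt with rfl | h1
    · exact hga h0
    · exact (hno c h0).not_gt h1
  have hanti : StrictAntiOn (fun x => f.eval x / g.eval x) (Set.Ici a) := by
    refine strictAntiOn_of_hasDerivWithinAt_neg (convex_Ici a)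
      (f.continuousOn.div g.continuousOn hne)
      (f' := fun x => ((derivative f).eval x * g.eval x - f.eval x * (derivative g).eval x)
      / g.eval x ^ 2) (fun c hc => ?_) (fun c hc => ?_)
    · exact ((f.hasDerivAt c).div (g.hasDerivAt c) (hne c (interior_subset hc))).hasDerivWithinAt
    · have hgc := hne c (interior_subset hc)
      have := h c
      simp only [eval_sub, eval_mul] at this
      exact div_neg_of_neg_of_pos this (by positivity)
  obtain ⟨c, h1, h2, h3⟩ := ((eventually_pos_of_leadingCoeff_pos hf).and
    ((eventually_pos_of_leadingCoeff_pos hg).and (eventually_gt_atTop a))).exists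
  have := hanti (Set.mem_Ici.2 le_rfl) (Set.mem_Ici.2 h3.le) h3
  simp only [ha, zero_div] at this
  exact (div_pos h1 h2).not_gt this

/-- The reflection `x ↦ -x` of a polynomial, with the sign that keeps the leading coefficient. -/
noncomputable def reflect (p : ℝ[X]) : ℝ[X] := C ((-1) ^ p.natDegree) * p.comp (-X)

theorem eval_reflect (p : ℝ[X]) (x : ℝ) :
    (reflect p).eval x = (-1) ^ p.natDegree * p.eval (-x) := by
  simp [reflect]

theorem eval_derivative_reflect (p : ℝ[X]) (x : ℝ) :
    (derivative (reflect p)).eval x = -((-1) ^ p.natDegree * (derivative p).eval (-x)) := by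
  rw [reflect, derivative_C_mul, derivative_comp]
  simp

theorem leadingCoeff_reflect (p : ℝ[X]) : (reflect p).leadingCoeff = p.leadingCoeff := by
  rw [reflect, leadingCoeff_mul, leadingCoeff_C, leadingCoeff_comp (by simp), leadingCoeff_neg,
    leadingCoeff_X, mul_left_comm, ← mul_pow]
  simp

/-- Reflection reduces this to `exists_root_above`. The sign from the odd degree sum cancels the
sign from differentiating `-x`, so the cross derivative stays negative. -/
theorem exists_root_below {f g : ℝ[X]}
    (h : ∀ x, (derivative f * g - f * derivative g).eval x < 0)
    (hf : 0 < f.leadingCoeff) (hg : 0 < g.leadingCoeff)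
    (hpar : Odd (f.natDegree + g.natDegree)) {a : ℝ} (ha : f.eval a = 0) :
    ∃ b, g.eval b = 0 ∧ b < a := by
  obtain ⟨b, hb, hab⟩ := exists_root_above (f := reflect f) (g := reflect g) (a := -a)
    (fun x => by
      have h1 := h (-x)
      have h2 := hpar.neg_one_pow (α := ℝ)
      rw [pow_add] at h2
      simp only [eval_sub, eval_mul, eval_reflect, eval_derivative_reflect] at h1 ⊢
      linear_combination h1 + (-eval (-x) (derivative f) * eval (-x) g
        + eval (-x) f * eval (-x) (derivative g)) * h2)
    (by rwa [leadingCoeff_reflect]) (by rwa [leadingCoeff_reflect]) (by simp [eval_reflect, ha])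
  refine ⟨-b, ?_, by linarith⟩
  simpa [eval_reflect] using hb

theorem exists_root_of_odd_natDegree {g : ℝ[X]} (hg : 0 < g.leadingCoeff)
    (hodd : Odd g.natDegree) : ∃ x, g.eval x = 0 := by
  obtain ⟨a, ha⟩ := (eventually_pos_of_leadingCoeff_pos hg).exists
  obtain ⟨b, hb⟩ := (eventually_pos_of_leadingCoeff_pos
    (p := reflect g) (by rwa [leadingCoeff_reflect])).exists
  rw [eval_reflect, hodd.neg_one_pow] at hb
  exact mem_range_of_exists_le_of_exists_ge g.continuous ⟨-b, by linarith⟩ ⟨a, ha.le⟩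

-- The leading behaviour of `x (f' g - f g')` is governed by `deg f - deg g < 0` times the leading
-- coefficients; without zeros the sign near infinity holds everywhere.
open Filter Topology in
theorem cross_derivative_neg {f g : ℝ[X]}
    (h : ∀ x, (derivative f * g - f * derivative g).eval x ≠ 0)
    (hf : 0 < f.leadingCoeff) (hg : 0 < g.leadingCoeff) (hlt : f.natDegree < g.natDegree) (x : ℝ) :
    (derivative f * g - f * derivative g).eval x < 0 := by
  set p := derivative f * g - f * derivative g with hp
  have hX : ∀ q : ℝ[X], Tendsto (fun x => (X * derivative q).eval x / x ^ q.natDegree) atTop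
      (𝓝 (q.natDegree * q.leadingCoeff)) := by
    intro q
    have hle : (X * derivative q).natDegree ≤ q.natDegree := by
      rcases Nat.eq_zero_or_pos q.natDegree with h0 | h0
      · rw [derivative_of_natDegree_zero h0]; simp
      · have := natDegree_derivative_lt h0.ne'
        refine natDegree_mul_le.trans ?_
        rw [natDegree_X]
        omega
    convert! tendsto_eval_div_pow hle using 2
    rw [leadingCoeff]
    rcases hq : q.natDegree with _ | m
    · simp
    · rw [coeff_X_mul, coeff_derivative, mul_comm]
      push_cast
      rfl
  have hlim := ((hX f).mul (tendsto_eval_div_pow (p := g) le_rfl)).sub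
    ((tendsto_eval_div_pow (p := f) le_rfl).mul (hX g))
  have hneg : (f.natDegree * f.leadingCoeff * g.coeff g.natDegree
      - f.coeff f.natDegree * (g.natDegree * g.leadingCoeff) : ℝ) < 0 := by
    rw [coeff_natDegree, coeff_natDegree]
    have h1 : (f.natDegree : ℝ) < g.natDegree := by exact_mod_cast hlt
    have h2 := mul_pos hf hg
    nlinarith
  obtain ⟨y, hy, hy0⟩ := ((hlim.eventually_lt_const hneg).and (eventually_gt_atTop 0)).exists
  have hpy : p.eval y < 0 := by
    have e : (X * derivative f).eval y / y ^ f.natDegree * (g.eval y / y ^ g.natDegree)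
        - f.eval y / y ^ f.natDegree * ((X * derivative g).eval y / y ^ g.natDegree)
        = p.eval y * (y / (y ^ f.natDegree * y ^ g.natDegree)) := by
      simp only [hp, eval_sub, eval_mul, eval_X]
      field_simp
    rw [e] at hy
    exact neg_of_mul_neg_left hy (by positivity)
  by_contra! hx
  obtain ⟨z, hz⟩ := mem_range_of_exists_le_of_exists_ge p.continuous ⟨y, hpy.le⟩ ⟨x, hx⟩
  exact h z hz

/-- Two polynomials with positive leading coefficients, degrees of different parity, and a
cross derivative `f' g - f g'` without real zeros have interlacing real zeros. -/
theorem strictlyInterlace_of_cross_derivative_ne_zero {k : ℕ} {f g : ℝ[X]}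
    (h : ∀ x, (derivative f * g - f * derivative g).eval x ≠ 0)
    (hf : 0 < f.leadingCoeff) (hg : 0 < g.leadingCoeff) (hlt : f.natDegree < g.natDegree)
    (hpar : Odd (f.natDegree + g.natDegree)) (hk : (realZeros f).encard = k)
    (hk0 : k = 0 → Odd g.natDegree) :
    StrictlyInterlace k (realZeros f) (realZeros g) ∧ (realZeros g).encard = (k + 1 : ℕ) := by
  have hneg := cross_derivative_neg h hf hg hlt
  have h' : ∀ x, (derivative g * f - g * derivative f).eval x ≠ 0 := by
    intro x h0
    refine h x ?_
    simp only [eval_sub, eval_mul] at h0 ⊢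
    linarith
  refine strictlyInterlace_of_separated hk ?_ ?_ ?_ ?_ ?_ ?_
  · rw [Set.disjoint_left]
    intro x (hx : f.eval x = 0) (hx' : g.eval x = 0)
    exact h x (by simp [hx, hx'])
  · obtain rfl | hk' := Nat.eq_zero_or_pos k
    · exact exists_root_of_odd_natDegree hg (hk0 rfl)
    · have : (realZeros f).Nonempty := by
        rw [← Set.encard_pos, hk]
        exact_mod_cast hk'
      obtain ⟨a, ha⟩ := this
      obtain ⟨b, hb, -⟩ := exists_root_above hneg hf hg ha
      exact ⟨b, hb⟩
  · exact fun a ha a' ha' haa => exists_root_between h haa ha ha'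
  · exact fun a ha a' ha' haa => exists_root_between h' haa ha ha'
  · exact fun a ha => exists_root_above hneg hf hg ha
  · exact fun a ha => exists_root_below hneg hf hg hpar ha

/-! ### Determinants of Chebyshev systems -/

theorem IsChebyshevSystem.det_ne_zero {ι : Type} [Fintype ι] {φ : ι → ℝ → ℝ} {I : Set ℝ}
    (h : IsChebyshevSystem φ I) {N : ℕ} (e : Fin N ≃ ι) {v : Fin N → ℝ}
    (hv : Function.Injective v) (hvI : ∀ k, v k ∈ I) :
    (Matrix.of fun i k => φ (e i) (v k)).det ≠ 0 := by
  intro h0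
  obtain ⟨a, ha, h1⟩ := Matrix.exists_vecMul_eq_zero_iff.2 h0
  have ha' : (fun i => a (e.symm i)) ≠ 0 := by
    intro hz
    refine ha (funext fun i => ?_)
    simpa using congrFun hz (e i)
  refine (h.2 _ ha').not_ge ?_
  have hcard : (Fintype.card ι : ℕ∞) = (Set.range v).encard := by
    rw [← Set.image_univ, hv.injOn.encard_image, ← Fintype.card_congr e]
    simp
  rw [hcard]
  refine Set.encard_le_encard ?_
  rintro _ ⟨k, rfl⟩
  refine ⟨hvI k, ?_⟩
  rw [← e.sum_comp]
  simpa [Matrix.vecMul, dotProduct] using congrFun h1 k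

theorem convex_strictMono_mem {J : Set ℝ} (hJ : Convex ℝ J) (N : ℕ) :
    Convex ℝ {v : Fin N → ℝ | StrictMono v ∧ ∀ k, v k ∈ J} := by
  intro v hv u hu a b ha hb hab
  refine ⟨fun i j hij => ?_, fun k => hJ (hv.2 k) (hu.2 k) ha hb hab⟩
  have h1 := hv.1 hij
  have h2 := hu.1 hij
  simp only [Pi.add_apply, Pi.smul_apply, smul_eq_mul]
  rcases ha.eq_or_lt with rfl | ha'
  · have : b = 1 := by linarith
    subst this; linarith
  · have := mul_lt_mul_of_pos_left h1 ha'
    have := mul_le_mul_of_nonneg_left h2.le hb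
    linarith

/-- The determinants of a Chebyshev system, multiplied by the Vandermonde determinant of the
nodes, have constant sign. -/
theorem exists_sign_det_mul_vandermonde {N : ℕ} (φ : Fin N → ℝ → ℝ) {J : Set ℝ} (hJ : Convex ℝ J)
    (hdet : ∀ v : Fin N → ℝ, Function.Injective v → (∀ k, v k ∈ J) →
      (Matrix.of fun i k => φ i (v k)).det ≠ 0)
    {ρ : ℝ → ℝ} (hρ : ∀ x ∈ J, 0 < ρ x) (hcont : ∀ i, ContinuousOn (fun x => φ i x / ρ x) J) :
    ∃ ε : ℝ, ∀ v : Fin N → ℝ, Function.Injective v → (∀ k, v k ∈ J) →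
      0 < ε * ((Matrix.of fun i k => φ i (v k)).det * (Matrix.vandermonde v).det) := by
  set T : Set (Fin N → ℝ) := {v | StrictMono v ∧ ∀ k, v k ∈ J} with hT
  -- Division by `ρ` makes the determinant continuous in the nodes without changing its sign. On the
  -- convex set `T` of increasing nodes it has no zero, hence one sign.
  set F : (Fin N → ℝ) → ℝ := fun v => (Matrix.of fun i k => φ i (v k) / ρ (v k)).det with hF
  have hFdet : ∀ v : Fin N → ℝ, F v
      = (∏ k, (ρ (v k))⁻¹) * (Matrix.of fun i k => φ i (v k)).det := by
    intro v
    rw [← Matrix.det_mul_row (fun k => (ρ (v k))⁻¹)]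
    simp only [hF, Matrix.of_apply]
    congr 1
    ext i k
    simp only [Matrix.of_apply]
    ring
  have hprod : ∀ v : Fin N → ℝ, (∀ k, v k ∈ J) → 0 < ∏ k, (ρ (v k))⁻¹ := fun v hv =>
    Finset.prod_pos fun k _ => inv_pos.2 (hρ _ (hv k))
  have hFne : ∀ v ∈ T, F v ≠ 0 := fun v hv => by
    rw [hFdet]
    exact mul_ne_zero (hprod v hv.2).ne' (hdet v hv.1.injective hv.2)
  have hFcont : ContinuousOn F T := by
    have hm : ContinuousOn (fun v : Fin N → ℝ =>
        (Matrix.of fun i k => φ i (v k) / ρ (v k) : Matrix (Fin N) (Fin N) ℝ)) T := by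
      refine continuousOn_pi.2 fun i => continuousOn_pi.2 fun k => ?_
      exact (hcont i).comp (continuous_apply k).continuousOn fun v hv => hv.2 k
    exact (continuous_id.matrix_det).comp_continuousOn hm
  have hconn : IsPreconnected T := (convex_strictMono_mem hJ N).isPreconnected
  have hsign : ∀ u ∈ T, ∀ v ∈ T, 0 < F u * F v := by
    intro u hu v hv
    by_contra! hle
    have h0 : (0 : ℝ) ∈ F '' T := by
      rcases lt_or_gt_of_ne (hFne u hu) with h | h
      · exact hconn.intermediate_value hu hv hFcont ⟨h.le, by nlinarith⟩
      · exact hconn.intermediate_value hv hu hFcont ⟨by nlinarith, h.le⟩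
    obtain ⟨z, hz, hz0⟩ := h0
    exact hFne z hz hz0
  have hsort : ∀ v : Fin N → ℝ, Function.Injective v → (∀ k, v k ∈ J) →
      v ∘ Tuple.sort v ∈ T := fun v hv hvJ =>
    ⟨(Tuple.monotone_sort v).strictMono_of_injective (hv.comp (Tuple.sort v).injective),
      fun k => hvJ _⟩
  by_cases hne : T.Nonempty
  · obtain ⟨u, hu⟩ := hne
    refine ⟨F u, fun v hv hvJ => ?_⟩
    -- Sorting the nodes multiplies both determinants by the sign of `σ`, so their product is
    -- unchanged.
    set σ := Tuple.sort v with hσ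
    have hs := hsort v hv hvJ
    have h1 := hsign u hu _ hs
    rw [hFdet (v ∘ σ)] at h1
    have hV : 0 < (Matrix.vandermonde (v ∘ σ)).det := by
      rw [Matrix.det_vandermonde]
      exact Finset.prod_pos fun i _ => Finset.prod_pos fun j hj =>
        sub_pos.2 (hs.1 (Finset.mem_Ioi.1 hj))
    have hP := hprod (v ∘ σ) hs.2
    have e1 : (Matrix.vandermonde (v ∘ σ)).det
        = (Equiv.Perm.sign σ : ℝ) * (Matrix.vandermonde v).det := by
      rw [← Matrix.det_permute]; rfl
    have e2 : (Matrix.of fun i k => φ i ((v ∘ σ) k)).det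
        = (Equiv.Perm.sign σ : ℝ) * (Matrix.of fun i k => φ i (v k)).det := by
      rw [← Matrix.det_permute']; rfl
    have e3 : ((Equiv.Perm.sign σ : ℤ) : ℝ) * ((Equiv.Perm.sign σ : ℤ) : ℝ) = 1 := by
      rw [← Int.cast_mul, ← Units.val_mul, Int.units_mul_self]; simp
    have h2 : 0 < F u * ((Matrix.of fun i k => φ i ((v ∘ σ) k)).det *
        (Matrix.vandermonde (v ∘ σ)).det) := by
      have : 0 < F u * (Matrix.of fun i k => φ i ((v ∘ σ) k)).det := by
        refine pos_of_mul_pos_right (a := ∏ k, (ρ ((v ∘ σ) k))⁻¹) ?_ hP.le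
        linarith
      rw [← mul_assoc]
      exact mul_pos this hV
    rw [e1, e2] at h2
    calc 0 < _ := h2
      _ = _ := by linear_combination (F u * (Matrix.of fun i k => φ i (v k)).det *
          (Matrix.vandermonde v).det) * e3
  · exact ⟨0, fun v hv hvJ => (hne ⟨_, hsort v hv hvJ⟩).elim⟩

/-! ### Sign changes of a polynomial and smaller multi-indices -/

/-- Roots in `J` are split off one at a time until the remaining factor keeps its sign; a root met
for the second time leaves `S`, and its square joins `R`. -/
theorem exists_prod_mul_constant_sign {J : Set ℝ} (hJ : IsPreconnected J) {Q : ℝ[X]} (hQ : Q ≠ 0) :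
    ∃ (S : Finset ℝ) (R : ℝ[X]), (∀ s ∈ S, s ∈ J) ∧ S.card ≤ Q.natDegree ∧
      Q = (∏ s ∈ S, (X - C s)) * R ∧
      ((∀ x ∈ J, 0 ≤ R.eval x) ∨ ∀ x ∈ J, R.eval x ≤ 0) := by
  classical
  induction hd : Q.natDegree generalizing Q with
  | zero =>
    refine ⟨∅, Q, by simp, by simp, by simp, ?_⟩
    rw [eq_C_of_natDegree_eq_zero hd]
    rcases le_total 0 (Q.coeff 0) with h | h
    · left; simpa using fun _ _ => h
    · right; simpa using fun _ _ => h
  | succ d ih =>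
    by_cases hs : (∀ x ∈ J, 0 ≤ Q.eval x) ∨ ∀ x ∈ J, Q.eval x ≤ 0
    · exact ⟨∅, Q, by simp, by simp, by simp, hs⟩
    push Not at hs
    obtain ⟨⟨a, ha, ha0⟩, ⟨b, hb, hb0⟩⟩ := hs
    obtain ⟨t, ht, ht0⟩ := hJ.intermediate_value ha hb Q.continuousOn ⟨ha0.le, hb0.le⟩
    obtain ⟨Q', rfl⟩ := dvd_iff_isRoot.2 (show Q.IsRoot t from ht0)
    have hQ' : Q' ≠ 0 := right_ne_zero_of_mul hQ
    have hd' : Q'.natDegree = d := by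
      rw [natDegree_mul (X_sub_C_ne_zero t) hQ', natDegree_X_sub_C] at hd
      omega
    obtain ⟨S, R, hSJ, hcard, hfac, hR⟩ := ih hQ' hd'
    by_cases htS : t ∈ S
    · refine ⟨S.erase t, (X - C t) ^ 2 * R, fun s hs => hSJ s (Finset.mem_of_mem_erase hs),
        (Finset.card_erase_le.trans hcard).trans d.le_succ, ?_, ?_⟩
      · rw [hfac, ← Finset.mul_prod_erase S _ htS]
        ring
      · simp only [eval_mul, eval_pow, eval_sub, eval_X, eval_C]
        rcases hR with hR | hR
        · exact Or.inl fun x hx => mul_nonneg (sq_nonneg _) (hR x hx)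
        · exact Or.inr fun x hx => mul_nonpos_of_nonneg_of_nonpos (sq_nonneg _) (hR x hx)
    · refine ⟨insert t S, R, ?_, ?_, ?_, hR⟩
      · intro s hs
        rcases Finset.mem_insert.1 hs with rfl | hs
        · exact ht
        · exact hSJ s hs
      · rw [Finset.card_insert_of_notMem htS]
        omega
      · rw [Finset.prod_insert htS, hfac]
        ring

theorem exists_le_size_eq {r : ℕ} (n : Fin r → ℕ) {m : ℕ} (hm : m ≤ size n) :
    ∃ n' : Fin r → ℕ, n' ≤ n ∧ size n' = m := by
  induction hk : size n - m generalizing m with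
  | zero => exact ⟨n, le_rfl, by omega⟩
  | succ k ih =>
    obtain ⟨n', hn', hs⟩ := ih (m := m + 1) (by omega) (by omega)
    obtain ⟨j, -, hj⟩ : ∃ j ∈ Finset.univ, n' j ≠ 0 := by
      refine Finset.exists_ne_zero_of_sum_ne_zero (s := Finset.univ) (f := n') ?_
      rw [show ∑ j, n' j = m + 1 from hs]
      omega
    refine ⟨Function.update n' j (n' j - 1), fun i => ?_, ?_⟩
    · rcases eq_or_ne i j with rfl | h
      · rw [Function.update_self]
        exact (Nat.sub_le _ _).trans (hn' i)
      · rw [Function.update_of_ne h]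
        exact hn' i
    · have h1 : ∑ j, n' j = m + 1 := hs
      rw [size, Finset.sum_update_of_mem (Finset.mem_univ j)]
      rw [← Finset.add_sum_erase _ _ (Finset.mem_univ j), ← Finset.sdiff_singleton_eq_erase] at h1
      omega

/-! ### Orthogonality against an AT system -/

section Weights

variable {r : ℕ} {w : Fin r → ℝ → ℝ} {I : Set ℝ}

theorem integrableOn_eval_mul_weight
    (hmom : ∀ (j : Fin r) (k : ℕ), IntegrableOn (fun x => x ^ k * w j x) I) (j : Fin r)
    (Q : ℝ[X]) (k : ℕ) : IntegrableOn (fun x => Q.eval x * x ^ k * w j x) I := by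
  have : (fun x => Q.eval x * x ^ k * w j x) = fun x => ∑ i ∈ Finset.range (Q.natDegree + 1),
      Q.coeff i * (x ^ (i + k) * w j x) := by
    ext x
    rw [eval_eq_sum_range, Finset.sum_mul, Finset.sum_mul]
    exact Finset.sum_congr rfl fun i _ => by ring
  rw [this]
  exact integrable_finsetSum _ fun i _ => (hmom j (i + k)).const_mul _

/-- On at most one point the functions form a space of dimension at most 1, so `w j` and `x * w j`
cannot be independent. -/
theorem interior_nonempty_of_isATSystem (hI : I.OrdConnected)
    (hAT : ∀ n : Fin r → ℕ, IsATSystem w I n) (j : Fin r) : (interior I).Nonempty := by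
  by_cases hs : I.Subsingleton
  · exfalso
    have : Subsingleton I := hs.coe_sort
    have hli := (hAT fun _ => 2).1
    let g : Fin 2 → (j : Fin r) × Fin 2 := fun k => ⟨j, k⟩
    have hg : Function.Injective g := fun a b h => by simpa [g] using h
    have hcard := (hli.comp g hg).fintype_card_le_finrank
    have hfin : Module.finrank ℝ (I → ℝ) ≤ 1 := by
      have := Fintype.ofFinite I
      rw [Module.finrank_pi]
      exact Fintype.card_le_one_iff_subsingleton.2 hs.coe_sort
    rw [Fintype.card_fin] at hcard
    omega
  · rw [Set.not_subsingleton_iff] at hs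
    obtain ⟨a, ha, b, hb, hab⟩ := hs.exists_lt
    have hsub : Set.Ioo a b ⊆ interior I :=
      interior_maximal (Set.Ioo_subset_Icc_self.trans (hI.out ha hb)) isOpen_Ioo
    exact (Set.nonempty_Ioo.2 hab).mono hsub

end Weights

/-- `Q` is orthogonal to `1, x, …, x ^ (n j - 1)` with respect to `w j`, for every `j`. -/
def IsOrthogonal {r : ℕ} (w : Fin r → ℝ → ℝ) (I : Set ℝ) (n : Fin r → ℕ) (Q : ℝ[X]) : Prop :=
  ∀ j : Fin r, ∀ k < n j, ∫ x in I, Q.eval x * x ^ k * w j x = 0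

section Weights

variable {r : ℕ} {w : Fin r → ℝ → ℝ} {I : Set ℝ}

theorem IsOrthogonal.mono {n m : Fin r → ℕ} {Q : ℝ[X]} (h : IsOrthogonal w I m Q) (hnm : n ≤ m) :
    IsOrthogonal w I n Q := fun j k hk => h j k (hk.trans_le (hnm j))

/-- Integration of a polynomial against `x ^ k * w j x`. -/
noncomputable def momentFunctional
    (hmom : ∀ (j : Fin r) (k : ℕ), IntegrableOn (fun x => x ^ k * w j x) I)
    (j : Fin r) (k : ℕ) : ℝ[X] →ₗ[ℝ] ℝ where
  toFun Q := ∫ x in I, Q.eval x * x ^ k * w j x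
  map_add' P Q := by
    rw [← integral_add (integrableOn_eval_mul_weight hmom j P k)
      (integrableOn_eval_mul_weight hmom j Q k)]
    simp only [eval_add, add_mul]
  map_smul' c Q := by
    rw [RingHom.id_apply, smul_eq_mul, ← integral_const_mul]
    simp only [eval_smul, smul_eq_mul, mul_assoc]

theorem isOrthogonal_iff
    (hmom : ∀ (j : Fin r) (k : ℕ), IntegrableOn (fun x => x ^ k * w j x) I) {n : Fin r → ℕ}
    {Q : ℝ[X]} :
    IsOrthogonal w I n Q ↔ ∀ j : Fin r, ∀ k < n j, momentFunctional hmom j k Q = 0 := Iff.rfl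

/-- The frontier of an interval is null, so only the interior matters; a nonnegative integrand with
integral zero vanishes almost everywhere, but a finite set cannot carry a nonempty open set. -/
theorem not_forall_nonneg_of_integral_eq_zero (hI : I.OrdConnected) (hne : (interior I).Nonempty)
    {h : ℝ → ℝ} (hint : IntegrableOn h I) (h0 : ∫ x in I, h x = 0) {Z : Set ℝ} (hZ : Z.Finite)
    (hpos : ∀ x ∈ interior I, x ∉ Z → h x ≠ 0) : ¬ ∀ x ∈ interior I, 0 ≤ h x := by
  intro hnonneg
  have hres : volume.restrict I = volume.restrict (interior I) :=
    Measure.restrict_congr_set (interior_ae_eq_of_null_frontier (hI.convex.addHaar_frontier volume)).symm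
  rw [IntegrableOn, hres] at hint
  rw [hres] at h0
  have hmem : ∀ᵐ x ∂volume.restrict (interior I), x ∈ interior I :=
    ae_restrict_mem isOpen_interior.measurableSet
  have hz := (integral_eq_zero_iff_of_nonneg_ae (hmem.mono hnonneg) hint).1 h0
  have hZ0 : ∀ᵐ x ∂volume.restrict (interior I), x ∉ Z :=
    ae_restrict_of_ae (measure_eq_zero_iff_ae_notMem.1 (hZ.measure_zero volume))
  have hfalse : ∀ᵐ x ∂volume.restrict (interior I), False := by
    filter_upwards [hz, hmem, hZ0] with x h1 h2 h3
    exact hpos x h2 h3 h1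
  rw [Filter.eventually_false_iff_eq_bot, ae_eq_bot, Measure.restrict_eq_zero] at hfalse
  exact (isOpen_interior.measure_pos volume hne).ne' hfalse

theorem det_vandermonde_cons {N : ℕ} (x : ℝ) (s : Fin N → ℝ) :
    (Matrix.vandermonde (Fin.cons x s : Fin (N + 1) → ℝ)).det
      = (∏ i, (s i - x)) * (Matrix.vandermonde s).det := by
  simp only [Matrix.det_vandermonde, Fin.prod_univ_succ, Fin.prod_Ioi_zero, Fin.prod_Ioi_succ,
    Fin.cons_zero, Fin.cons_succ]

/-- For a finite set `S` in the interior of `I` with `|S| + 1 = |n|`, a linear combination of the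
functions of the system changes sign in the interior exactly at the points of `S`. -/
theorem exists_combination_prod_pos (hI : I.OrdConnected)
    (hcont : ∃ ρ : ℝ → ℝ, (∀ x ∈ interior I, 0 < ρ x) ∧
      ∀ j : Fin r, ContinuousOn (fun x => w j x / ρ x) (interior I))
    {n : Fin r → ℕ} (hAT : IsATSystem w I n) {S : Finset ℝ} (hS : ∀ s ∈ S, s ∈ interior I)
    (hcard : size n = S.card + 1) :
    ∃ a : (j : Fin r) × Fin (n j) → ℝ, ∀ x ∈ interior I, x ∉ S →
      0 < (∏ s ∈ S, (x - s)) * ∑ i, a i * (x ^ (i.2 : ℕ) * w i.1 x) := by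
  obtain ⟨ρ, hρ, hc⟩ := hcont
  set N := S.card with hN
  have e : Fin (N + 1) ≃ (j : Fin r) × Fin (n j) :=
    (Fintype.equivFinOfCardEq (by simpa [size] using hcard)).symm
  set φ : Fin (N + 1) → ℝ → ℝ := fun i x => x ^ ((e i).2 : ℕ) * w (e i).1 x with hφ
  obtain ⟨ε, hε⟩ := exists_sign_det_mul_vandermonde φ (J := interior I)
    hI.convex.interior
    (fun v hv hvI => hAT.det_ne_zero e hv fun k => interior_subset (hvI k)) hρ
    (fun i => by
      have := (continuous_pow (M := ℝ) ((e i).2 : ℕ)).continuousOn.mul (hc (e i).1)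
      refine this.congr fun x _ => ?_
      simp only [hφ, Pi.mul_apply]
      ring)
  set s : Fin N → ℝ := ⇑(S.orderEmbOfFin hN.symm) with hs
  have hsinj : Function.Injective s := (S.orderEmbOfFin hN.symm).injective
  have hsS : ∀ i, s i ∈ S := fun i => S.orderEmbOfFin_mem hN.symm i
  have hprodS : ∀ x : ℝ, ∏ i, (s i - x) = (-1) ^ N * ∏ t ∈ S, (x - t) := by
    intro x
    have himg : Finset.univ.image s = S :=
      Finset.eq_of_subset_of_card_le (Finset.image_subset_iff.2 fun i _ => hsS i)
        (by rw [Finset.card_image_of_injective _ hsinj]; simp [hN])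
    rw [← himg, Finset.prod_image hsinj.injOn, ← Fin.prod_const, ← Finset.prod_mul_distrib]
    exact Finset.prod_congr rfl fun i _ => by ring
  -- The determinant with nodes `x` and the points of `S`, expanded along the column of `x`, is a
  -- combination of the system with the cofactors `b` as coefficients. Its sign is that of `ε` times
  -- the Vandermonde determinant, in which `x` enters through `∏ (s - x)`; `κ` collects the factors
  -- independent of `x`.
  set κ : ℝ := ε * ((-1) ^ N * (Matrix.vandermonde s).det) with hκ
  set b : Fin (N + 1) → ℝ := fun i => (-1) ^ (i : ℕ) *
    (Matrix.of fun (p q : Fin N) => φ (i.succAbove p) (s q)).det with hb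
  refine ⟨fun i => κ * b (e.symm i), fun x hx hxS => ?_⟩
  have hinj : Function.Injective (Fin.cons x s : Fin (N + 1) → ℝ) :=
    Fin.cons_injective_iff.2 ⟨fun ⟨i, hi⟩ => hxS (hi ▸ hsS i), hsinj⟩
  have key := hε (Fin.cons x s) hinj fun k => by
    refine Fin.cases hx (fun k => ?_) k
    exact hS _ (hsS k)
  have hexp : (Matrix.of fun i k => φ i ((Fin.cons x s : Fin (N + 1) → ℝ) k)).det
      = ∑ i, b i * φ i x := by
    rw [Matrix.det_succ_column_zero]
    refine Finset.sum_congr rfl fun i _ => ?_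
    simp only [hb, Matrix.of_apply, Fin.cons_zero]
    rw [mul_right_comm]
    congr 2
  have hsum : ∑ i, κ * b (e.symm i) * (x ^ (i.2 : ℕ) * w i.1 x) = κ * ∑ i, b i * φ i x := by
    rw [← e.sum_comp, Finset.mul_sum]
    refine Finset.sum_congr rfl fun i _ => ?_
    simp only [Equiv.symm_apply_apply, hφ]
    ring
  rw [hexp, det_vandermonde_cons, hprodS] at key
  rw [hsum, hκ]
  linarith

/-- A nonzero polynomial orthogonal to an AT system of size `|n|` and divisible by
`(X - x₀) ^ l` with `l` even has degree at least `|n| + l`. -/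
theorem IsOrthogonal.le_natDegree (hI : I.OrdConnected)
    (hmom : ∀ (j : Fin r) (k : ℕ), IntegrableOn (fun x => x ^ k * w j x) I)
    (hcont : ∃ ρ : ℝ → ℝ, (∀ x ∈ interior I, 0 < ρ x) ∧
      ∀ j : Fin r, ContinuousOn (fun x => w j x / ρ x) (interior I))
    (hAT : ∀ n : Fin r → ℕ, IsATSystem w I n) {n : Fin r → ℕ} {Q : ℝ[X]}
    (hQ : IsOrthogonal w I n Q) (hQ0 : Q ≠ 0) {l : ℕ} (hl : Even l) {x₀ : ℝ}
    (hdvd : (X - C x₀) ^ l ∣ Q) : size n + l ≤ Q.natDegree := by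
  by_contra! hlt
  obtain ⟨Q', hQ'⟩ := hdvd
  have hQ'0 : Q' ≠ 0 := by
    rintro rfl
    exact hQ0 (by simpa using hQ')
  have hdeg : Q.natDegree = l + Q'.natDegree := by
    rw [hQ', natDegree_mul (pow_ne_zero _ (X_sub_C_ne_zero _)) hQ'0, natDegree_pow,
      natDegree_X_sub_C, mul_one]
  obtain ⟨S, R, hSI, hScard, hfac, hR⟩ :=
    exists_prod_mul_constant_sign (J := interior I) hI.convex.interior.isPreconnected hQ'0
  -- Possible because `S.card ≤ deg Q' = deg Q - l < |n|`. A smaller multi-index fits the number of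
  -- sign changes exactly, and `Q` stays orthogonal to its system.
  obtain ⟨n', hn', hsize⟩ := exists_le_size_eq n (m := S.card + 1) (by omega)
  obtain ⟨a, ha⟩ := exists_combination_prod_pos hI hcont (hAT n') hSI hsize
  have hne : (interior I).Nonempty := by
    obtain ⟨j, -, -⟩ : ∃ j ∈ Finset.univ, n' j ≠ 0 := by
      refine Finset.exists_ne_zero_of_sum_ne_zero (s := Finset.univ) (f := n') ?_
      rw [show ∑ j, n' j = S.card + 1 from hsize]
      omega
    exact interior_nonempty_of_isATSystem hI hAT j
  set φ : ℝ → ℝ := fun x => ∑ i, a i * (x ^ (i.2 : ℕ) * w i.1 x) with hφ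
  have hexp : (fun x => Q.eval x * φ x)
      = fun x => ∑ i, a i * (Q.eval x * x ^ (i.2 : ℕ) * w i.1 x) := by
    ext x
    simp only [hφ, Finset.mul_sum]
    exact Finset.sum_congr rfl fun i _ => by ring
  have hint_i : ∀ i : (j : Fin r) × Fin (n' j),
      IntegrableOn (fun x => a i * (Q.eval x * x ^ (i.2 : ℕ) * w i.1 x)) I := fun i =>
    (integrableOn_eval_mul_weight hmom i.1 Q i.2).const_mul _
  have hint : IntegrableOn (fun x => Q.eval x * φ x) I := by
    rw [hexp]
    exact integrable_finsetSum _ fun i _ => hint_i i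
  have hzero : ∫ x in I, Q.eval x * φ x = 0 := by
    rw [hexp, integral_finsetSum _ fun i _ => hint_i i]
    refine Finset.sum_eq_zero fun i _ => ?_
    rw [integral_const_mul, hQ.mono hn' i.1 i.2 i.2.2, mul_zero]
  have hform : ∀ x, Q.eval x * φ x
      = (((∏ s ∈ S, (x - s)) * φ x) * (x - x₀) ^ l) * R.eval x := by
    intro x
    rw [hQ', hfac]
    simp only [eval_mul, eval_pow, eval_sub, eval_X, eval_C, eval_prod]
    ring
  have hnn : ∀ x ∈ interior I, 0 ≤ ((∏ s ∈ S, (x - s)) * φ x) * (x - x₀) ^ l := by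
    intro x hx
    refine mul_nonneg ?_ (hl.pow_nonneg _)
    by_cases hxS : x ∈ S
    · rw [Finset.prod_eq_zero hxS (sub_self x), zero_mul]
    · exact (ha x hx hxS).le
  have hZ : {x | Q.eval x = 0 ∨ x ∈ S}.Finite :=
    (Q.rootSet_finite ℝ |>.subset fun x (hx : Q.eval x = 0) => by
      simpa [mem_rootSet, hQ0] using hx).union S.finite_toSet
  have hne0 : ∀ x ∈ interior I, x ∉ {x | Q.eval x = 0 ∨ x ∈ S} → Q.eval x * φ x ≠ 0 := by
    intro x hx hxZ
    rw [Set.mem_ofPred_eq, not_or] at hxZ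
    exact mul_ne_zero hxZ.1 (right_ne_zero_of_mul (ha x hx hxZ.2).ne')
  rcases hR with hR | hR
  · refine not_forall_nonneg_of_integral_eq_zero hI hne hint hzero hZ hne0 fun x hx => ?_
    rw [hform]
    exact mul_nonneg (hnn x hx) (hR x hx)
  · refine not_forall_nonneg_of_integral_eq_zero hI hne hint.neg
      (by simpa [integral_neg] using hzero) hZ (fun x hx hxZ => neg_ne_zero.2 (hne0 x hx hxZ))
      fun x hx => ?_
    rw [Pi.neg_apply, hform]
    exact neg_nonneg.2 (mul_nonpos_of_nonneg_of_nonpos (hnn x hx) (hR x hx))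

/-- The orthogonality conditions on polynomials of degree below `|n|` form a square linear system.
Its kernel is trivial by `IsOrthogonal.le_natDegree` with `l = 0`, so some `q` of lower degree has
the same moments as `X ^ |n|`. -/
theorem existsUnique_isTypeII (hI : I.OrdConnected)
    (hmom : ∀ (j : Fin r) (k : ℕ), IntegrableOn (fun x => x ^ k * w j x) I)
    (hcont : ∃ ρ : ℝ → ℝ, (∀ x ∈ interior I, 0 < ρ x) ∧
      ∀ j : Fin r, ContinuousOn (fun x => w j x / ρ x) (interior I))
    (hAT : ∀ n : Fin r → ℕ, IsATSystem w I n) (n : Fin r → ℕ) : ∃! P : ℝ[X], IsTypeII w I n P := by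
  have hzero : ∀ Q : ℝ[X], Q.degree < size n → IsOrthogonal w I n Q → Q = 0 := by
    intro Q hdeg hQ
    by_contra hQ0
    have := hQ.le_natDegree hI hmom hcont hAT hQ0 (l := 0) (by simp) (x₀ := 0) (by simp)
    rw [degree_eq_natDegree hQ0] at hdeg
    have : Q.natDegree < size n := by exact_mod_cast hdeg
    omega
  let Φ : ℝ[X] →ₗ[ℝ] ((j : Fin r) × Fin (n j) → ℝ) :=
    LinearMap.pi fun i => momentFunctional hmom i.1 i.2
  have hΦ : ∀ Q, Φ Q = 0 ↔ IsOrthogonal w I n Q := by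
    intro Q
    rw [isOrthogonal_iff hmom]
    exact ⟨fun h j k hk => congrFun h ⟨j, ⟨k, hk⟩⟩, fun h => funext fun i => h i.1 i.2 i.2.2⟩
  let Ψ : (Fin (size n) → ℝ) →ₗ[ℝ] ((j : Fin r) × Fin (n j) → ℝ) :=
    (Φ.comp (degreeLT ℝ (size n)).subtype).comp (degreeLTEquiv ℝ (size n)).symm.toLinearMap
  have hinj : Function.Injective Ψ := by
    rw [← LinearMap.ker_eq_bot, LinearMap.ker_eq_bot']
    intro v hv
    have h1 := hzero _ (mem_degreeLT.1 ((degreeLTEquiv ℝ (size n)).symm v).2) ((hΦ _).1 hv)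
    exact (degreeLTEquiv ℝ (size n)).symm.map_eq_zero_iff.1 (Subtype.ext h1)
  have hsurj : Function.Surjective Ψ :=
    (LinearMap.injective_iff_surjective_of_finrank_eq_finrank
      (by
        rw [Module.finrank_fin_fun, Module.finrank_fintype_fun_eq_card, Fintype.card_sigma]
        simp [size])).1 hinj
  obtain ⟨v, hv⟩ := hsurj (Φ (X ^ size n))
  set q : ℝ[X] := ((degreeLTEquiv ℝ (size n)).symm v : ℝ[X]) with hq
  have hqdeg : q.degree < size n := mem_degreeLT.1 ((degreeLTEquiv ℝ (size n)).symm v).2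
  have hv' : Φ q = Φ (X ^ size n) := hv
  refine ⟨X ^ size n - q, ⟨monic_X_pow_sub hqdeg, ?_, ?_⟩, ?_⟩
  · refine natDegree_eq_of_degree_eq_some ?_
    rw [degree_sub_eq_left_of_degree_lt (by rwa [degree_X_pow]), degree_X_pow]
  · exact (hΦ _).1 (by rw [map_sub, hv', sub_self])
  · rintro P ⟨hP, hPd, hPo⟩
    have hPo' := (hΦ P).2 hPo
    rw [← sub_eq_zero]
    refine hzero _ ?_ ((hΦ _).1 (by rw [map_sub, hPo', map_sub, hv', sub_self, sub_zero]))
    have h1 : P - (X ^ size n - q) = (P - X ^ size n) + q := by ring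
    rw [h1]
    refine (degree_add_le _ _).trans_lt (max_lt ?_ hqdeg)
    have hPdeg : P.degree = size n := by rw [degree_eq_natDegree hP.ne_zero, hPd]
    rw [← hPdeg]
    exact degree_sub_lt_left (by rw [hPdeg, degree_X_pow]) hP.ne_zero (by simp [hP.leadingCoeff])

/-- The Wronskian of an even number of orthogonal polynomials of consecutive degrees has no
real zeros. -/
theorem wronskianDet_eval_ne_zero_of_even (hI : I.OrdConnected)
    (hmom : ∀ (j : Fin r) (k : ℕ), IntegrableOn (fun x => x ^ k * w j x) I)
    (hcont : ∃ ρ : ℝ → ℝ, (∀ x ∈ interior I, 0 < ρ x) ∧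
      ∀ j : Fin r, ContinuousOn (fun x => w j x / ρ x) (interior I))
    (hAT : ∀ n : Fin r → ℕ, IsATSystem w I n) {n : Fin r → ℕ} {l : ℕ} (hl : Even l)
    {f : Fin l → ℝ[X]} (hmonic : ∀ j, (f j).Monic)
    (hdeg : ∀ j, (f j).natDegree = size n + j) (horth : ∀ j, IsOrthogonal w I n (f j)) (x : ℝ) :
    (wronskianDet f).eval x ≠ 0 := by
  intro h0
  rw [wronskianDet, eval_det] at h0
  obtain ⟨c, hc, hc0⟩ := Matrix.exists_mulVec_eq_zero_iff.2 h0
  set Q : ℝ[X] := ∑ j, c j • f j with hQ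
  -- The Wronskian is a nonzero polynomial by its leading coefficient, so the polynomials are
  -- linearly independent.
  have hQ0 : Q ≠ 0 := by
    intro h
    have hW : wronskianDet f ≠ 0 := leadingCoeff_ne_zero.1
      (wronskianDet_natDegree_leadingCoeff f (size n) hmonic hdeg).2.ne'
    have hC : (fun j => C (c j)) = 0 := by
      refine Matrix.eq_zero_of_mulVec_eq_zero hW (funext fun i => ?_)
      have hi := congrArg derivative^[(i : ℕ)] h
      rw [hQ, iterate_derivative_sum, iterate_derivative_zero] at hi
      simp only [smul_eq_C_mul, iterate_derivative_C_mul] at hi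
      simpa [Matrix.mulVec, dotProduct, mul_comm] using hi
    exact hc (funext fun j => C_eq_zero.1 (congrFun hC j))
  -- Row `i` of the kernel relation says that the `i`-th derivative of `Q` vanishes at `x`, for all
  -- `i < l`.
  have hdvd : (X - C x) ^ l ∣ Q := by
    rcases Nat.eq_zero_or_pos l with rfl | hlpos
    · simp
    rw [← le_rootMultiplicity_iff hQ0]
    have : l - 1 < Q.rootMultiplicity x := by
      rw [lt_rootMultiplicity_iff_isRoot_iterate_derivative hQ0]
      intro m hm
      have := congrFun hc0 ⟨m, by omega⟩
      simp only [Matrix.mulVec, dotProduct, Matrix.of_apply, Pi.zero_apply] at this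
      rw [IsRoot, hQ, iterate_derivative_sum, eval_finsetSum, ← this]
      refine Finset.sum_congr rfl fun j _ => ?_
      rw [iterate_derivative_smul, eval_smul, smul_eq_mul, mul_comm]
    omega
  have hQorth : IsOrthogonal w I n Q := by
    rw [isOrthogonal_iff hmom]
    intro j k hk
    rw [hQ, map_sum]
    refine Finset.sum_eq_zero fun i _ => ?_
    rw [map_smul, (isOrthogonal_iff hmom).1 (horth i) j k hk, smul_zero]
  have h1 := hQorth.le_natDegree hI hmom hcont hAT hQ0 hl hdvd
  have h2 : Q.natDegree ≤ size n + (l - 1) := by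
    refine natDegree_sum_le_of_forall_le _ _ fun j _ => ?_
    refine (natDegree_smul_le _ _).trans ?_
    rw [hdeg]
    have := j.2
    omega
  have hlpos : 0 < l := by
    rcases Nat.eq_zero_or_pos l with rfl | h
    · exact (hc (funext fun j => j.elim0)).elim
    · exact h
  omega

end Weights

/-- The weights have moments, are continuous up to a common factor, and form an AT system for
every multi-index. -/
structure IsAdmissible {r : ℕ} (w : Fin r → ℝ → ℝ) (I : Set ℝ) : Prop where
  ordConnected : I.OrdConnected
  moments : ∀ (j : Fin r) (k : ℕ), IntegrableOn (fun x => x ^ k * w j x) I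
  continuous : ∃ ρ : ℝ → ℝ, (∀ x ∈ interior I, 0 < ρ x) ∧
      ∀ j : Fin r, ContinuousOn (fun x => w j x / ρ x) (interior I)
  isATSystem : ∀ n : Fin r → ℕ, IsATSystem w I n

/-! ### Wronskians along paths -/

section Weights

variable {r : ℕ} {w : Fin r → ℝ → ℝ} {I : Set ℝ}

theorem IsAdmissible.typeII_spec (h : IsAdmissible w I) (n : Fin r → ℕ) :
    IsTypeII w I n (typeII w I n) :=
  Classical.epsilon_spec
    (existsUnique_isTypeII h.ordConnected h.moments h.continuous h.isATSystem n).exists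

theorem IsPath.le {l : ℕ} {n : Fin r → ℕ} {p : Fin l → Fin r → ℕ} (hp : IsPath n p) (j : Fin l) :
    n ≤ p j := by
  have hpos : 0 < l := j.pos
  rw [← hp.1 ⟨0, hpos⟩ rfl]
  exact hp.2.2 (Nat.zero_le _)

theorem IsAdmissible.pathWronskian_natDegree_leadingCoeff (h : IsAdmissible w I) {l : ℕ}
    {n : Fin r → ℕ} {p : Fin l → Fin r → ℕ} (hp : IsPath n p) :
    (pathWronskian w I p).natDegree = l * size n ∧ 0 < (pathWronskian w I p).leadingCoeff :=
  wronskianDet_natDegree_leadingCoeff _ _ (fun j => (h.typeII_spec (p j)).1)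
    fun j => by rw [(h.typeII_spec (p j)).2.1, hp.2.1 j]

theorem IsAdmissible.pathWronskian_eval_ne_zero (h : IsAdmissible w I) {l : ℕ} (hl : Even l)
    {n : Fin r → ℕ} {p : Fin l → Fin r → ℕ} (hp : IsPath n p) (x : ℝ) :
    (pathWronskian w I p).eval x ≠ 0 :=
  wronskianDet_eval_ne_zero_of_even h.ordConnected h.moments h.continuous h.isATSystem hl
    (n := n) (fun j => (h.typeII_spec (p j)).1)
    (fun j => by rw [(h.typeII_spec (p j)).2.1, hp.2.1 j])
    (fun j => IsOrthogonal.mono (h.typeII_spec (p j)).2.2 (hp.le j)) x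

theorem IsPath.castSucc {l : ℕ} {n : Fin r → ℕ} {p : Fin (l + 1) → Fin r → ℕ} (hp : IsPath n p) :
    IsPath n fun j : Fin l => p j.castSucc :=
  ⟨fun _ hj => hp.1 _ hj, fun _ => hp.2.1 _, fun _ _ hij => hp.2.2 hij⟩

theorem IsPath.succ {l : ℕ} {n : Fin r → ℕ} {p : Fin (l + 2) → Fin r → ℕ} (hp : IsPath n p) :
    IsPath (p 1) fun j : Fin (l + 1) => p j.succ := by
  refine ⟨fun j hj => ?_, fun j => ?_, fun _ _ hij => hp.2.2 (Fin.succ_le_succ_iff.2 hij)⟩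
  · obtain rfl : j = 0 := Fin.ext hj
    rfl
  · rw [hp.2.1 j.succ, hp.2.1 1, Fin.val_succ, Fin.val_one]
    omega

/-- Both the whole path, of length `k + 2`, and its middle part, of length `k`, have even length;
for `k = 0` the middle Wronskian is the empty determinant `1`. -/
theorem IsAdmissible.cross_derivative_ne_zero (h : IsAdmissible w I) {k : ℕ} (hk : Even k)
    {n : Fin r → ℕ} {p : Fin (k + 2) → Fin r → ℕ} (hp : IsPath n p) (x : ℝ) :
    (derivative (pathWronskian w I fun j => p j.castSucc) * pathWronskian w I (fun j => p j.succ)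
      - pathWronskian w I (fun j => p j.castSucc)
        * derivative (pathWronskian w I fun j => p j.succ)).eval x ≠ 0 :=
  wronskianDet_jacobi_ne_zero (fun j => typeII w I (p j)) x
    (h.pathWronskian_eval_ne_zero (by simpa [Nat.even_add] using hk) hp x)
    (h.pathWronskian_eval_ne_zero hk hp.succ.castSucc x)

theorem IsAdmissible.interlace (h : IsAdmissible w I) {k : ℕ} (hk : Even k)
    {n : Fin r → ℕ} {p : Fin (k + 2) → Fin r → ℕ} (hp : IsPath n p)
    (hcount : (realZeros (pathWronskian w I fun j => p j.castSucc)).encard = size n) :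
    StrictlyInterlace (size n) (realZeros (pathWronskian w I fun j => p j.castSucc))
        (realZeros (pathWronskian w I fun j => p j.succ)) ∧
      (realZeros (pathWronskian w I fun j => p j.succ)).encard = (size n + 1 : ℕ) := by
  obtain ⟨d1, l1⟩ := h.pathWronskian_natDegree_leadingCoeff hp.castSucc
  obtain ⟨d2, l2⟩ := h.pathWronskian_natDegree_leadingCoeff hp.succ
  have hs : size (p 1) = size n + 1 := by rw [hp.2.1 1, Fin.val_one]
  rw [hs] at d2
  have hk1 : Odd (k + 1) := hk.add_one
  refine strictlyInterlace_of_cross_derivative_ne_zero (h.cross_derivative_ne_zero hk hp) l1 l2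
    ?_ ?_ hcount ?_
  · rw [d1, d2]
    exact Nat.mul_lt_mul_of_pos_left (Nat.lt_succ_self _) k.succ_pos
  -- The degrees add up to `(k + 1) * (2 * |n| + 1)`, a product of odd numbers.
  · rw [d1, d2, ← mul_add]
    exact hk1.mul ⟨size n, by ring⟩
  · intro h0
    rw [d2, h0]
    simpa using hk1

/-- The induction on `|n|` runs backwards along paths: the given path is the tail of a longer one
whose initial part starts at a multi-index of size one less. -/
theorem exists_path_extension {l : ℕ} {n : Fin r → ℕ} {p : Fin (l + 1) → Fin r → ℕ}
    (hp : IsPath n p) (hn : size n ≠ 0) :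
    ∃ (n' : Fin r → ℕ) (q : Fin (l + 2) → Fin r → ℕ), IsPath n' q ∧ size n = size n' + 1 ∧
      (fun j => q j.succ) = p := by
  obtain ⟨n', hle, hs⟩ := exists_le_size_eq n (m := size n - 1) (Nat.sub_le _ _)
  have hs' : size n = size n' + 1 := by omega
  refine ⟨n', Fin.cons n' p, ⟨?_, ?_, ?_⟩, hs', by ext; simp⟩
  · intro j hj
    obtain rfl : j = 0 := Fin.ext hj
    rfl
  · intro j
    refine Fin.cases ?_ (fun j => ?_) j
    · simp
    · rw [Fin.cons_succ, hp.2.1, hs', Fin.val_succ]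
      omega
  · intro i j
    refine Fin.cases ?_ (fun i => ?_) i
    · refine Fin.cases (fun _ => le_rfl) (fun j _ => ?_) j
      rw [Fin.cons_zero, Fin.cons_succ]
      exact hle.trans (hp.le j)
    · refine Fin.cases (fun hij => ?_) (fun j hij => ?_) j
      · simp at hij
      · rw [Fin.cons_succ, Fin.cons_succ]
        exact hp.2.2 (Fin.succ_le_succ_iff.1 hij)

theorem IsAdmissible.encard_realZeros (h : IsAdmissible w I) {k : ℕ} (hk : Even k)
    {n : Fin r → ℕ} {p : Fin (k + 1) → Fin r → ℕ} (hp : IsPath n p) :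
    (realZeros (pathWronskian w I p)).encard = size n ∧
      ∀ x ∈ realZeros (pathWronskian w I p), (pathWronskian w I p).rootMultiplicity x = 1 := by
  induction hm : size n generalizing n p with
  | zero =>
    obtain ⟨d, lc⟩ := h.pathWronskian_natDegree_leadingCoeff hp
    have hempty : realZeros (pathWronskian w I p) = ∅ := by
      rw [hm, mul_zero] at d
      refine Set.eq_empty_of_forall_notMem fun x (hx : eval x _ = 0) => ?_
      rw [eq_C_of_natDegree_eq_zero d, eval_C, ← d] at hx
      exact lc.ne' hx
    simp [hempty]
  | succ m ih =>
    obtain ⟨n', q, hq, hs, rfl⟩ := exists_path_extension hp (by omega)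
    have hm' : size n' = m := by omega
    have hc := (ih hq.castSucc hm').1
    rw [← hm'] at hc
    refine ⟨by rw [(h.interlace hk hq hc).2, hm'], fun x (hx : eval x _ = 0) => ?_⟩
    have hcross := h.cross_derivative_ne_zero hk hq x
    set g := pathWronskian w I fun j => q j.succ
    -- A multiple zero of `g` would be a zero of the cross derivative.
    have hder : (derivative g).eval x ≠ 0 := by
      intro h0
      exact hcross (by simp [hx, h0])
    have hg0 : g ≠ 0 := by
      intro h0
      exact hder (by simp [h0])
    refine le_antisymm ?_ ((rootMultiplicity_pos hg0).2 hx)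
    by_contra! hlt
    exact hder ((one_lt_rootMultiplicity_iff_isRoot hg0).1 hlt).2

end Weights

end MOP

/-! ### The main theorem -/

theorem theorem1p2 {r : ℕ} (w : Fin r → ℝ → ℝ) (I : Set ℝ) (hI : I.OrdConnected)
    (hmom : ∀ (j : Fin r) (k : ℕ), IntegrableOn (fun x => x ^ k * w j x) I)
    (hcont : ∃ ρ : ℝ → ℝ, (∀ x ∈ interior I, 0 < ρ x) ∧
      ∀ j : Fin r, ContinuousOn (fun x => w j x / ρ x) (interior I))
    (hAT : ∀ n : Fin r → ℕ, MOP.IsATSystem w I n)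
    {l : ℕ} (hl : Odd l) :
    (∀ n : Fin r → ℕ, ∃! P : ℝ[X], MOP.IsTypeII w I n P) ∧
    (∀ (n : Fin r → ℕ) (p : Fin l → Fin r → ℕ), MOP.IsPath n p →
      (MOP.realZeros (MOP.pathWronskian w I p)).encard = (MOP.size n : ℕ∞) ∧
      ∀ x ∈ MOP.realZeros (MOP.pathWronskian w I p),
        (MOP.pathWronskian w I p).rootMultiplicity x = 1) ∧
    (∀ (n n' m : Fin r → ℕ) (p q : Fin l → Fin r → ℕ),
      MOP.IsPath n p → MOP.IsPath n' q →
      (∀ j : Fin l, (j : ℕ) + 1 = l → q j = m) →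
      (∀ i j : Fin l, (i : ℕ) = (j : ℕ) + 1 → p i = q j) →
      MOP.size m = MOP.size n + l → n ≤ m →
      MOP.StrictlyInterlace (MOP.size n)
        (MOP.realZeros (MOP.pathWronskian w I p))
        (MOP.realZeros (MOP.pathWronskian w I q))) := by
  have h : MOP.IsAdmissible w I := ⟨hI, hmom, hcont, hAT⟩
  obtain ⟨k, rfl⟩ : ∃ k, l = k + 1 := ⟨l - 1, by have := hl.pos; omega⟩
  have hk : Even k := by simpa [Nat.odd_add_one] using hl
  refine ⟨MOP.existsUnique_isTypeII hI hmom hcont hAT, fun n p hp => h.encard_realZeros hk hp, ?_⟩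
  intro n n' m p q hp hq hqm hpq hsize hnm
  have hlast : q (Fin.last k) = m := hqm _ rfl
  -- Appending `m` to `p` glues the two paths into one of length `l + 1`, with `p` as initial and
  -- `q` as final part. For `l = 1` nothing overlaps, and that `u` is a path rests on `hsize` and
  -- `hnm`.
  set u : Fin (k + 2) → Fin r → ℕ := Fin.snoc p m with hu
  have hcast : (fun j : Fin (k + 1) => u j.castSucc) = p := by
    ext1 j
    simp [hu]
  have hsucc : (fun j : Fin (k + 1) => u j.succ) = q := by
    ext1 j
    refine Fin.lastCases ?_ (fun j => ?_) j
    · rw [Fin.succ_last, hlast]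
      simp [hu]
    · rw [Fin.succ_castSucc]
      simp only [hu, Fin.snoc_castSucc]
      exact hpq _ _ (by simp)
  have hle : ∀ j, p j ≤ m := by
    intro j
    refine Fin.cases ?_ (fun j => ?_) j
    · rw [hp.1 0 rfl]
      exact hnm
    · rw [hpq j.succ j.castSucc (by simp), ← hlast]
      exact hq.2.2 (Fin.le_last _)
  have hpath : MOP.IsPath n u := by
    refine ⟨fun j hj => ?_, fun j => ?_, fun i j => ?_⟩
    · obtain rfl : j = Fin.castSucc 0 := Fin.ext hj
      simpa [hu] using hp.1 0 rfl
    · refine Fin.lastCases ?_ (fun j => ?_) j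
      · simpa [hu] using hsize
      · simpa [hu] using hp.2.1 j
    · refine Fin.lastCases (fun hij => ?_) (fun i => ?_) i
      · rw [Fin.last_le_iff.1 hij]
      · refine Fin.lastCases (fun _ => ?_) (fun j hij => ?_) j
        · simpa [hu] using hle i
        · simpa [hu] using hp.2.2 (Fin.castSucc_le_castSucc_iff.1 hij)
  have hres := (h.interlace hk hpath (by rw [hcast]; exact (h.encard_realZeros hk hp).1)).1
  rwa [hcast, hsucc] at hres
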